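/- **Setting.** Identify the split-quaternions with the real $2\times 2$ matrices so that $\mathbf 1$ is the identity matrix and $\mathbf i=\begin{pmatrix}0&-1\\1&0\end{pmatrix}$, $\mathbf j'=\begin{pmatrix}0&1\\1&0\end{pmatrix}$, $\mathbf k'=\begin{pmatrix}-1&0\\0&1\end{pmatrix}$, with $\langle X,Y\rangle=\frac12\{\mathrm{tr}(XY)-\mathrm{tr}X\,\mathrm{tr}Y\}$. Let $G=\mathrm{SL}_2\mathbb R$, with Lie algebra $\mathfrak g=\mathbb R\mathbf i\oplus\mathbb R\mathbf j'\oplus\mathbb R\mathbf k'$ (Minkowski 3-space). The pseudosphere $S^2_1=\{x\in\mathfrak g:\langle x,x\rangle=1\}$ is the $\mathrm{Ad}(G)$-orbit of $\mathbf k'$. Let $K$ be the isotropy group of $\mathbf k'$, and $\mathfrak g=\mathfrak k\oplus\mathfrak m$ with $\mathfrak k=\mathbb R\mathbf k'$, $\mathfrak m=\mathbb R\mathbf i\oplus\mathbb R\mathbf j'$. Let $\mathbb D$ be a simply connected open subset of the plane with null coordinates $(u,v)$ and the conformal class of $du\,dv$. Its split-complex structure is $\partial_u\mapsto\partial_u$,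 $\partial_v\mapsto-\partial_v$; that of $S^2_1$ at $x$ is $\xi\mapsto\frac12[x,\xi]$. A smooth map $\psi:\mathbb D\to S^2_1$ is called *Lorentz conformal* if $d\psi$ commutes with these split-complex structures. (This includes every smooth orientation-preserving $\psi$ that pulls the metric of $S^2_1$ back to a positive multiple of $du\,dv$.) A *framing* of $\psi$ is a smooth $\Psi:\mathbb D\to G$ with $\mathrm{Ad}(\Psi)\mathbf k'=\psi$. Let $\alpha=\Psi^{-1}d\Psi=\alpha_{\mathfrak k}+\alpha'_{\mathfrak m}+\alpha''_{\mathfrak m}$, where $\alpha'_{\mathfrak m}$ and $\alpha''_{\mathfrak m}$ are the $du$- and $dv$-parts of $\alpha_{\mathfrak m}$, and $\alpha_\lambda=\alpha_{\mathfrak k}+\lambda\alpha'_{\mathfrak m}+\lambda^{-1}\alpha''_{\mathfrak m}$ for $\lambda\in\mathbb R^+$. An *extended framing* is a family of smooth maps $\Psi_\lambda:\mathbb D\to G$, $\lambda\in\mathbb R^+$, with $d\Psi_\lambda=\Psi_\lambda\alpha_\lambda$ and $\Psi_1=\Psi$; then $\psi_\lambda=\mathrm{Ad}(\Psi_\lambda)\mathbf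 k'$ is an *associated family* of $\psi$. It is *normalized* at $p_0\in\mathbb D$ if $\Psi_\lambda(p_0)$ does not depend on $\lambda$. For $\lambda=e^\theta\in\mathbb R^+$, interpret $\lambda$ as the element $\cosh\theta\,\mathbf 1+\sinh\theta\,\mathbf k'$ of $K$, so that $\lambda^{1/2}$ is $\cosh\frac\theta2\,\mathbf 1+\sinh\frac\theta2\,\mathbf k'$, acting on $S^2_1$ by $\mathrm{Ad}$. **Corollary 7.2.** Let $\psi:\mathbb D\to S^2_1$ be a Lorentz conformal map. 1. If $p_0\in\mathbb D$ and $\psi(p_0)=\mathbf k'$, then an associated family of $\psi$ normalized at $p_0$ exists, and every such family $\{\psi_\lambda\}$ consists of harmonic maps (solutions of $\square\psi_\lambda+\langle d\psi_\lambda,d\psi_\lambda\rangle\psi_\lambda=0$) and satisfies $$\psi_\lambda=\lambda^{1/2}\psi=\mathrm{Ad}(\lambda^{1/2})\psi\qquad(\lambda\in\mathbb R^+).$$ 2. With no normalization and no condition on the values of $\psi$, the family $\{\lambda^{1/2}\psi\}_{\lambda\in\mathbb R^+}$ is an associated family of $\psi$; and for every associated family $\{\psi_\lambda\}$ of $\psi$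 and every $\lambda\in\mathbb R^+$, $\psi_\lambda$ is harmonic and there is $g\in G$ with $\psi_\lambda=\mathrm{Ad}(g)(\lambda^{1/2}\psi)$ on $\mathbb D$. -/

import Mathlib

open scoped ContDiff

namespace LorentzSphere

/-- Real `2 × 2` matrices, as a model of the algebra of split-quaternions: `1`, `𝐢`, `𝐣'`, `𝐤'`
correspond to the identity matrix and to `qi`, `qj`, `qk` below. -/
abbrev M2 : Type := Matrix (Fin 2) (Fin 2) ℝ

/-- The group `G` of timelike unit split-quaternions, i.e. `SL(2, ℝ)`. -/
abbrev G : Type := Matrix.SpecialLinearGroup (Fin 2) ℝ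

/-- The split-quaternion `𝐢`. -/
def qi : M2 := !![0, -1; 1, 0]

/-- The split-quaternion `𝐣'`. -/
def qj : M2 := !![0, 1; 1, 0]

/-- The split-quaternion `𝐤'`. -/
def qk : M2 := !![-1, 0; 0, 1]

/-- The scalar product of split-quaternions, in matrix form. -/
noncomputable def sprod (X Y : M2) : ℝ :=
  (1 / 2) * ((X * Y).trace - X.trace * Y.trace)

/-- Minkowski 3-space `𝔤 = ℝ𝐢 ⊕ ℝ𝐣' ⊕ ℝ𝐤'` (trace-free matrices) contains the unit pseudosphere
`S²₁`, the set of its vectors of square `1`. -/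
def S21 : Set M2 := {x | x.trace = 0 ∧ sprod x x = 1}

/-- In the coordinates of the basis `𝐢, 𝐣', 𝐤'`, `S²₁` is the one-sheeted hyperboloid. -/
theorem mem_S21_iff (a b c : ℝ) :
    a • qi + b • qj + c • qk ∈ S21 ↔ -a ^ 2 + b ^ 2 + c ^ 2 = 1 := by
  simp only [S21, sprod, qi, qj, qk, Set.mem_ofPred_eq, Matrix.trace_fin_two, Matrix.mul_apply,
    Fin.sum_univ_two, Matrix.add_apply, Matrix.smul_apply, smul_eq_mul]
  simp
  constructor <;> intro h <;> nlinarith [h]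

/-- The adjoint action of `G`. -/
def Ad (g : G) (x : M2) : M2 := (g : M2) * x * ((g⁻¹ : G) : M2)

/-- The split-complex structure of the tangent plane of `S²₁` at `x`: the vector product with `x`,
`ξ ↦ x × ξ = [x, ξ] / 2`. It is the `Ad(G)`-invariant structure whose `(+1)`- and
`(-1)`-eigenspaces at the origin `𝐤'` are spanned by `!![0, 0; 1, 0]` and `!![0, 1; 0, 0]`. -/
noncomputable def sphereK (x ξ : M2) : M2 := (1 / 2 : ℝ) • (x * ξ - ξ * x)

theorem sphereK_plus : sphereK qk !![0, 0; 1, 0] = !![0, 0; 1, 0] := by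
  ext i j; fin_cases i <;> fin_cases j <;> simp [sphereK, qk]; norm_num

theorem sphereK_minus : sphereK qk !![0, 1; 0, 0] = -!![0, 1; 0, 0] := by
  ext i j; fin_cases i <;> fin_cases j <;> simp [sphereK, qk]; norm_num

theorem sphereK_Ad (g : G) (x ξ : M2) : sphereK (Ad g x) (Ad g ξ) = Ad g (sphereK x ξ) := by
  have h : ((g⁻¹ : G) : M2) * (g : M2) = 1 := by
    rw [← Matrix.SpecialLinearGroup.coe_mul]; simp
  have key : ∀ a b : M2, Ad g a * Ad g b = Ad g (a * b) := by
    intro a b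
    unfold Ad
    calc (g : M2) * a * ((g⁻¹ : G) : M2) * ((g : M2) * b * ((g⁻¹ : G) : M2))
        = (g : M2) * a * (((g⁻¹ : G) : M2) * (g : M2)) * b * ((g⁻¹ : G) : M2) := by
          simp only [Matrix.mul_assoc]
      _ = _ := by rw [h]; simp only [Matrix.mul_assoc, Matrix.one_mul]
  unfold sphereK
  rw [key, key]
  simp [Ad, Matrix.mul_sub, Matrix.sub_mul]

/-! ### Calculus on a plane region with null coordinates `(u, v)`

The Lorentz surface is an open set `D ⊆ ℝ × ℝ` with the conformal class of `du dv`. -/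

/-- A matrix-valued map is smooth on `D`. -/
def SmoothOn (D : Set (ℝ × ℝ)) (F : ℝ × ℝ → M2) : Prop :=
  ∀ i j, ContDiffOn ℝ ∞ (fun p => F p i j) D

/-- The differential of a matrix-valued map at `p`, applied to the tangent vector `X`. -/
noncomputable def diff (F : ℝ × ℝ → M2) (p X : ℝ × ℝ) : M2 :=
  Matrix.of fun i j => fderiv ℝ (fun q => F q i j) p X

/-- The split-complex structure of the conformal class of `du dv`:
`∂/∂u ↦ ∂/∂u`, `∂/∂v ↦ -∂/∂v`. -/
def planeK (X : ℝ × ℝ) : ℝ × ℝ := (X.1, -X.2)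

/-- A smooth map `ψ : D → S²₁` is Lorentz conformal if its differential intertwines the
split-complex structures of `D` and `S²₁`. -/
structure IsLorentzConformal (D : Set (ℝ × ℝ)) (ψ : ℝ × ℝ → M2) : Prop where
  smooth : SmoothOn D ψ
  mapsTo : Set.MapsTo ψ D S21
  comm : ∀ p ∈ D, ∀ X : ℝ × ℝ, diff ψ p (planeK X) = sphereK (ψ p) (diff ψ p X)

/-- The wave map equation `□ψ + ⟨dψ, dψ⟩ ψ = 0` for the metric `du dv`, for which
`□ = 4 ∂²/∂u∂v` and `⟨dψ, dψ⟩ = 4 ⟨ψ_u, ψ_v⟩`. -/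
structure IsHarmonic (D : Set (ℝ × ℝ)) (ψ : ℝ × ℝ → M2) : Prop where
  smooth : SmoothOn D ψ
  mapsTo : Set.MapsTo ψ D S21
  eqn : ∀ p ∈ D,
    (4 : ℝ) • diff (fun q => diff ψ q (0, 1)) p (1, 0) +
      (4 * sprod (diff ψ p (1, 0)) (diff ψ p (0, 1))) • ψ p = 0

/-! ### Framings and the associated family -/

/-- A framing of `ψ` on `D`: a smooth lift `Ψ : D → G` through `g ↦ Ad(g) 𝐤'`. -/
structure IsFraming (D : Set (ℝ × ℝ)) (ψ : ℝ × ℝ → M2) (Ψ : ℝ × ℝ → G) : Prop where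
  smooth : SmoothOn D (fun p => (Ψ p : M2))
  proj : ∀ p ∈ D, Ad (Ψ p) qk = ψ p

/-- The pull-back `α = Ψ⁻¹ dΨ` of the Maurer-Cartan form. -/
noncomputable def mcForm (Ψ : ℝ × ℝ → G) (p X : ℝ × ℝ) : M2 :=
  (((Ψ p)⁻¹ : G) : M2) * diff (fun q => (Ψ q : M2)) p X

/-- The projection of `𝔤 = 𝔨 ⊕ 𝔪` onto `𝔨 = ℝ𝐤'`. -/
noncomputable def kPart (x : M2) : M2 := ((x 1 1 - x 0 0) / 2) • qk

/-- The projection of `𝔤 = 𝔨 ⊕ 𝔪` onto `𝔪 = ℝ𝐢 ⊕ ℝ𝐣'`. -/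
def mPart (x : M2) : M2 := !![0, x 0 1; x 1 0, 0]

/-- For `α = Ψ⁻¹ dΨ`, the form `α_l = α_𝔨 + l α'_𝔪 + l⁻¹ α''_𝔪`; the `(1,0)`-part and
the `(0,1)`-part of a one-form are its `du`-part and its `dv`-part. -/
noncomputable def spectralForm (Ψ : ℝ × ℝ → G) (l : ℝ) (p X : ℝ × ℝ) : M2 :=
  kPart (mcForm Ψ p X) + l • mPart (mcForm Ψ p (X.1, 0)) + l⁻¹ • mPart (mcForm Ψ p (0, X.2))

/-- An extended framing of `ψ` on `D`: framings `Ψ_l`, `l > 0`, where `Ψ = Ψ_1` is a framing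
of `ψ`, with `dΨ_l = Ψ_l α_l` for `α = Ψ⁻¹ dΨ`. -/
structure IsExtendedFraming (D : Set (ℝ × ℝ)) (ψ : ℝ × ℝ → M2) (F : ℝ → ℝ × ℝ → G) : Prop where
  framing : IsFraming D ψ (F 1)
  smooth : ∀ l : ℝ, 0 < l → SmoothOn D (fun p => (F l p : M2))
  eqn : ∀ l : ℝ, 0 < l → ∀ p ∈ D, ∀ X : ℝ × ℝ,
    diff (fun q => (F l q : M2)) p X = (F l p : M2) * spectralForm (F 1) l p X

/-- `fam` is an associated family of `ψ`, with arbitrary integration constants: the projection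
`Ad(Ψ_l) 𝐤'` of an extended framing of `ψ`. -/
def IsAssociatedFamily (D : Set (ℝ × ℝ)) (ψ : ℝ × ℝ → M2) (fam : ℝ → ℝ × ℝ → M2) : Prop :=
  ∃ F : ℝ → ℝ × ℝ → G, IsExtendedFraming D ψ F ∧
    ∀ l : ℝ, 0 < l → ∀ p ∈ D, fam l p = Ad (F l p) qk

/-- `fam` is the associated family of `ψ` normalized at the base point `p₀`: the initial value
`Ψ_l(p₀)` of the extended framing does not depend on `l`. -/
def IsAssociatedFamilyAt (D : Set (ℝ × ℝ)) (ψ : ℝ × ℝ → M2) (p₀ : ℝ × ℝ)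
    (fam : ℝ → ℝ × ℝ → M2) : Prop :=
  ∃ F : ℝ → ℝ × ℝ → G, IsExtendedFraming D ψ F ∧ (∀ l : ℝ, 0 < l → F l p₀ = F 1 p₀) ∧
    ∀ l : ℝ, 0 < l → ∀ p ∈ D, fam l p = Ad (F l p) qk

/-- A positive number `l = exp θ` regarded as the element `cosh θ 1 + sinh θ 𝐤'` of the isotropy
group `K` of `𝐤'`. -/
noncomputable def isotropyElt (l : ℝ) : G :=
  ⟨Real.cosh (Real.log l) • (1 : M2) + Real.sinh (Real.log l) • qk, by
    have h := Real.cosh_sq (Real.log l)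
    generalize Real.cosh (Real.log l) = c at *
    generalize Real.sinh (Real.log l) = s at *
    simp [Matrix.det_fin_two, qk]
    linear_combination h⟩

theorem isotropyElt_fixes (l : ℝ) : Ad (isotropyElt l) qk = qk := by
  have hc : (isotropyElt l : M2) * qk = qk * (isotropyElt l : M2) := by
    simp [isotropyElt, Matrix.mul_add, Matrix.add_mul]
  have h : (isotropyElt l : M2) * (((isotropyElt l)⁻¹ : G) : M2) = 1 := by
    rw [← Matrix.SpecialLinearGroup.coe_mul]; simp
  unfold Ad
  rw [hc, Matrix.mul_assoc, h, Matrix.mul_one]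

/-! ### Comparison with the metric description of conformality

A smooth map that pulls the metric of `S²₁` back to a positive multiple of `du dv` and preserves
the orientations is Lorentz conformal in the above sense. -/

theorem mul_add_mul_swap (X Y : M2) (hX : X.trace = 0) (hY : Y.trace = 0) :
    X * Y + Y * X = (2 * sprod X Y) • (1 : M2) := by
  rw [Matrix.trace_fin_two] at hX hY
  have h1 : X 1 1 = -X 0 0 := by linarith
  have h2 : Y 1 1 = -Y 0 0 := by linarith
  ext i j
  fin_cases i <;> fin_cases j <;>
    simp [sprod, Matrix.mul_apply, Fin.sum_univ_two, Matrix.trace_fin_two, h1, h2] <;> ring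

theorem sphereK_of_null (x X Y : M2) (hx : x.trace = 0) (hX : X.trace = 0) (hY : Y.trace = 0)
    (hxx : sprod x x = 1) (hxX : sprod x X = 0) (hxY : sprod x Y = 0)
    (hXX : sprod X X = 0) (hYY : sprod Y Y = 0) (hXY : 0 < sprod X Y)
    (ho : 0 < sprod (sphereK x X) Y) : sphereK x X = X ∧ sphereK x Y = -Y := by
  have exx := mul_add_mul_swap x x hx hx
  have exX := mul_add_mul_swap x X hx hX
  have exY := mul_add_mul_swap x Y hx hY
  have eXX := mul_add_mul_swap X X hX hX
  have eYY := mul_add_mul_swap Y Y hY hY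
  have eXY := mul_add_mul_swap X Y hX hY
  have two : ∀ A B : M2, A + A = (2 : ℝ) • B → A = B := by
    intro A B h
    rw [← two_smul ℝ A] at h
    exact smul_right_injective M2 (two_ne_zero' ℝ) h
  have xx : x * x = 1 := two _ _ (by rw [exx, hxx, mul_one])
  have XX : X * X = 0 := two _ _ (by rw [eXX, hXX]; simp)
  have YY : Y * Y = 0 := two _ _ (by rw [eYY, hYY]; simp)
  have xX : X * x = -(x * X) := by
    rw [hxX] at exX; simp at exX; exact (neg_eq_of_add_eq_zero_right exX).symm
  have xY : Y * x = -(x * Y) := by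
    rw [hxY] at exY; simp at exY; exact (neg_eq_of_add_eq_zero_right exY).symm
  have kX : sphereK x X = x * X := by
    unfold sphereK; rw [xX, sub_neg_eq_add, ← two_smul ℝ (x * X), smul_smul]; norm_num
  have kY : sphereK x Y = x * Y := by
    unfold sphereK; rw [xY, sub_neg_eq_add, ← two_smul ℝ (x * Y), smul_smul]; norm_num
  rw [kX] at ho
  rw [kX, kY]
  have tX : (x * X).trace = 0 := by
    have := congrArg Matrix.trace xX
    rw [Matrix.trace_neg, Matrix.trace_mul_comm] at this
    linarith
  have ew := mul_add_mul_swap (x * X) Y tX hY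
  set m := sprod X Y
  set w := sprod (x * X) Y
  have YX : Y * X = (2 * m) • (1 : M2) - X * Y := by rw [← eXY]; abel
  -- the two basic identities `m xX = w X` and `m xY = -w Y`
  have h1 : m • (x * X) = w • X := by
    have := congrArg (fun Z => X * Z) ew
    simp only [Matrix.mul_add] at this
    have a1 : X * (x * X * Y) = 0 := by
      rw [← Matrix.mul_assoc, ← Matrix.mul_assoc, xX, Matrix.neg_mul, Matrix.mul_assoc x X X, XX]
      simp
    have a2 : X * (Y * (x * X)) = (2 * m) • (x * X) := by
      calc X * (Y * (x * X)) = -(X * (Y * X) * x) := by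
            rw [show x * X = -(X * x) by rw [xX, neg_neg]]; simp [Matrix.mul_assoc]
        _ = (2 * m) • (x * X) := by
            rw [YX, Matrix.mul_sub, ← Matrix.mul_assoc X X Y, XX]; simp [xX]
    rw [a1, a2, zero_add] at this
    have h2 : (2 : ℝ) • (m • (x * X)) = (2 : ℝ) • (w • X) := by
      rw [smul_smul, smul_smul, this]; simp
    exact smul_right_injective M2 (two_ne_zero' ℝ) h2
  have h2 : m • (x * Y) = -(w • Y) := by
    have := congrArg (fun Z => Z * Y) ew
    simp only [Matrix.add_mul] at this
    have a1 : x * X * Y * Y = 0 := by rw [Matrix.mul_assoc, YY]; simp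
    have a2 : Y * (x * X) * Y = -((2 * m) • (x * Y)) := by
      calc Y * (x * X) * Y = -(x * ((Y * X) * Y)) := by
            rw [← Matrix.mul_assoc Y x X, xY]; simp [Matrix.mul_assoc]
        _ = -((2 * m) • (x * Y)) := by
            rw [YX, Matrix.sub_mul, Matrix.mul_assoc X Y Y, YY]; simp
    rw [a1, a2, zero_add] at this
    have h3 : (2 : ℝ) • (m • (x * Y)) = (2 : ℝ) • (-(w • Y)) := by
      rw [smul_smul, ← neg_neg ((2 * m) • (x * Y)), this]; simp [smul_smul]
    exact smul_right_injective M2 (two_ne_zero' ℝ) h3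
  have hX0 : X ≠ 0 := by
    intro h
    have : m = 0 := by simp [m, sprod, h]
    linarith
  have hwm : w = m := by
    have h3 : (m * m) • X = (w * w) • X := by
      have e := congrArg (fun Z => m • (x * Z)) h1
      simp only [Matrix.mul_smul, ← Matrix.mul_assoc, xx, Matrix.one_mul] at e
      rw [smul_smul, smul_comm m w, h1, smul_smul] at e
      exact e
    have h4 : m * m = w * w := by
      have h5 : (m * m - w * w) • X = 0 := by rw [sub_smul, h3, sub_self]
      exact sub_eq_zero.mp ((smul_eq_zero.mp h5).resolve_right hX0)
    nlinarith [h4]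
  rw [hwm] at h1 h2
  refine ⟨smul_right_injective M2 hXY.ne' h1, smul_right_injective M2 hXY.ne' ?_⟩
  simpa using h2

theorem isLorentzConformal_of_pullback (D : Set (ℝ × ℝ)) (hD : IsOpen D) (ψ : ℝ × ℝ → M2)
    (hs : SmoothOn D ψ) (hm : Set.MapsTo ψ D S21) (μ : ℝ × ℝ → ℝ) (hμ : ∀ p ∈ D, 0 < μ p)
    (hpull : ∀ p ∈ D, ∀ X Y : ℝ × ℝ,
      sprod (diff ψ p X) (diff ψ p Y) = μ p * ((X.1 * Y.2 + X.2 * Y.1) / 2))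
    (hor : ∀ p ∈ D, 0 < sprod (sphereK (ψ p) (diff ψ p (1, 0))) (diff ψ p (0, 1))) :
    IsLorentzConformal D ψ := by
  refine ⟨hs, hm, fun p hp X => ?_⟩
  have hd : ∀ i j, DifferentiableAt ℝ (fun q => ψ q i j) p := fun i j =>
    ((hs i j).contDiffAt (hD.mem_nhds hp)).differentiableAt (by simp)
  have hev : ∀ᶠ q in nhds p, ψ q ∈ S21 := Filter.mem_of_superset (hD.mem_nhds hp) hm
  -- tangency of the differential
  have htr : ∀ Y, (diff ψ p Y).trace = 0 := by
    intro Y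
    have e : (fun q => ψ q 0 0 + ψ q 1 1) =ᶠ[nhds p] fun _ => (0 : ℝ) := by
      filter_upwards [hev] with q hq
      rw [← Matrix.trace_fin_two]; exact hq.1
    have e1 := e.fderiv_eq (𝕜 := ℝ)
    rw [fderiv_fun_add (hd 0 0) (hd 1 1)] at e1
    have := congrArg (fun L : ℝ × ℝ →L[ℝ] ℝ => L Y) e1
    simpa [Matrix.trace_fin_two, diff] using this
  have hto : ∀ Y, sprod (ψ p) (diff ψ p Y) = 0 := by
    intro Y
    have e : (fun q => ψ q 0 0 * ψ q 0 0 + ψ q 0 1 * ψ q 1 0) =ᶠ[nhds p] fun _ => (1 : ℝ) := by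
      filter_upwards [hev] with q hq
      have h1 := hq.1
      have h2 := hq.2
      rw [Matrix.trace_fin_two] at h1
      have h3 : ψ q 1 1 = -ψ q 0 0 := by linarith
      simp [sprod, Matrix.trace_fin_two, Matrix.mul_apply, Fin.sum_univ_two, h3] at h2
      linarith
    have e1 := e.fderiv_eq (𝕜 := ℝ)
    rw [fderiv_fun_add ((hd 0 0).fun_mul (hd 0 0)) ((hd 0 1).fun_mul (hd 1 0)),
      fderiv_fun_mul (hd 0 0) (hd 0 0), fderiv_fun_mul (hd 0 1) (hd 1 0)] at e1
    have := congrArg (fun L : ℝ × ℝ →L[ℝ] ℝ => L Y) e1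
    have t0 := (hm hp).1
    have t1 := htr Y
    rw [Matrix.trace_fin_two] at t0 t1
    have t2 : ψ p 1 1 = -ψ p 0 0 := by linarith
    have t3 : diff ψ p Y 1 1 = -diff ψ p Y 0 0 := by linarith
    simp [sprod, Matrix.trace_fin_two, Matrix.mul_apply, Fin.sum_univ_two, t2, t3]
    simp at this
    simp [diff]
    linarith
  have hlin : ∀ Z : ℝ × ℝ, diff ψ p Z = Z.1 • diff ψ p (1, 0) + Z.2 • diff ψ p (0, 1) := by
    intro Z
    ext i j
    have : Z = Z.1 • ((1 : ℝ), (0 : ℝ)) + Z.2 • ((0 : ℝ), (1 : ℝ)) := by ext <;> simp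
    simp only [diff, Matrix.of_apply, Matrix.add_apply, Matrix.smul_apply]
    conv_lhs => rw [this]
    rw [map_add, map_smul, map_smul]
  obtain ⟨h1, h2⟩ := sphereK_of_null (ψ p) (diff ψ p (1, 0)) (diff ψ p (0, 1)) (hm hp).1
    (htr _) (htr _) (hm hp).2 (hto _) (hto _) (by rw [hpull p hp]; simp)
    (by rw [hpull p hp]; simp) (by rw [hpull p hp]; simpa using hμ p hp) (hor p hp)
  have hK : ∀ (a b : ℝ) (A B : M2),
      sphereK (ψ p) (a • A + b • B) = a • sphereK (ψ p) A + b • sphereK (ψ p) B := by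
    intro a b A B
    simp only [sphereK, Matrix.mul_add, Matrix.add_mul, Matrix.mul_smul, Matrix.smul_mul]
    module
  rw [hlin X, hlin (planeK X), hK, h1, h2]
  simp [planeK]

end LorentzSphere

namespace LorentzSphere

/-! ### Calculus of matrix-valued maps -/

section Calculus

variable {D : Set (ℝ × ℝ)} {F H : ℝ × ℝ → M2} {p X : ℝ × ℝ}

/-! Write `h` for `λ^(1/2)` and `α` for `Ψ⁻¹ dΨ`. Read through a framing, conformality says that the
`𝔪`-part of `α` has only a lower-left entry in its `du`-part and only an upper-right entry in its
`dv`-part. Since `h = diag(λ^(-1/2), λ^(1/2))`, conjugation by `h` multiplies these entries by `λ`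
and `λ⁻¹` and fixes the diagonal. Hence `α_λ = Ad(h) α` (`IsFraming.spectralForm_eq`), and `h Ψ h⁻¹`
is an extended framing. As `h` fixes `𝐤'`, it projects to `Ad(h) ψ`.

A map into `G` is determined by its Maurer-Cartan form up to a constant left factor on a connected
domain, so every extended framing is `Ψ_λ = g Ψ h⁻¹` with `g` depending only on `λ`, and it projects
to `Ad(g) ψ`. If it is normalized over `𝐤'`, then `Ψ(p₀)` lies in the commutative group `K`, and
evaluation at `p₀` gives `g = h`. Harmonicity follows because `Ad(g) ψ` is again conformal, and
conformal maps are harmonic (`IsLorentzConformal.isHarmonic`).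

A framing exists because the (-1)-eigenline of `ψ` can be spanned by a smooth nowhere zero vector
field: its square, as a complex number, is an explicit nonvanishing function, which has a root on a
simply connected domain (`exists_isFraming`). -/

theorem SmoothOn.contDiffAt (hF : SmoothOn D F) (hD : IsOpen D) (hp : p ∈ D) (i j : Fin 2) :
    ContDiffAt ℝ ∞ (fun q => F q i j) p :=
  (hF i j).contDiffAt (hD.mem_nhds hp)

theorem SmoothOn.differentiableAt (hF : SmoothOn D F) (hD : IsOpen D) (hp : p ∈ D)
    (i j : Fin 2) : DifferentiableAt ℝ (fun q => F q i j) p :=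
  (hF.contDiffAt hD hp i j).differentiableAt (by simp)

theorem smoothOn_const (A : M2) : SmoothOn D fun _ => A := fun _ _ => contDiffOn_const

theorem SmoothOn.congr (hF : SmoothOn D F) (h : ∀ p ∈ D, H p = F p) : SmoothOn D H :=
  fun i j => (hF i j).congr fun p hp => by simp [h p hp]

theorem SmoothOn.mul (hF : SmoothOn D F) (hH : SmoothOn D H) :
    SmoothOn D fun p => F p * H p := by
  intro i j
  simp only [Matrix.mul_apply, Fin.sum_univ_two]
  exact ((hF i 0).mul (hH 0 j)).add ((hF i 1).mul (hH 1 j))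

theorem SmoothOn.diff (hF : SmoothOn D F) (hD : IsOpen D) (X : ℝ × ℝ) :
    SmoothOn D fun p => diff F p X := by
  intro i j
  simp only [LorentzSphere.diff, Matrix.of_apply]
  exact ((hF i j).fderiv_of_isOpen hD (by simp)).clm_apply contDiffOn_const

theorem coe_inv (g : G) :
    ((g⁻¹ : G) : M2) = !![(g : M2) 1 1, -(g : M2) 0 1; -(g : M2) 1 0, (g : M2) 0 0] := by
  rw [Matrix.SpecialLinearGroup.coe_inv, Matrix.adjugate_fin_two]

theorem coe_mul_inv (g : G) : (g : M2) * ((g⁻¹ : G) : M2) = 1 := by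
  rw [← Matrix.SpecialLinearGroup.coe_mul]; simp

theorem coe_inv_mul (g : G) : ((g⁻¹ : G) : M2) * (g : M2) = 1 := by
  rw [← Matrix.SpecialLinearGroup.coe_mul]; simp

theorem SmoothOn.inv {Ψ : ℝ × ℝ → G} (h : SmoothOn D fun p => (Ψ p : M2)) :
    SmoothOn D fun p => (((Ψ p)⁻¹ : G) : M2) := by
  intro i j
  simp only [coe_inv]
  fin_cases i <;> fin_cases j
  exacts [h 1 1, (h 0 1).neg, (h 1 0).neg, h 0 0]

theorem diff_mul (hF : ∀ i j, DifferentiableAt ℝ (fun q => F q i j) p)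
    (hH : ∀ i j, DifferentiableAt ℝ (fun q => H q i j) p) (X : ℝ × ℝ) :
    diff (fun q => F q * H q) p X = diff F p X * H p + F p * diff H p X := by
  ext i j
  simp only [diff, Matrix.mul_apply, Fin.sum_univ_two, Matrix.of_apply, Matrix.add_apply]
  rw [fderiv_fun_add ((hF _ _).fun_mul (hH _ _)) ((hF _ _).fun_mul (hH _ _)),
    fderiv_fun_mul (hF _ _) (hH _ _), fderiv_fun_mul (hF _ _) (hH _ _)]
  simp
  ring

theorem diff_const (A : M2) (p X : ℝ × ℝ) : diff (fun _ => A) p X = 0 := by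
  ext i j; simp [diff]

theorem diff_const_mul (A : M2) (hF : ∀ i j, DifferentiableAt ℝ (fun q => F q i j) p)
    (X : ℝ × ℝ) : diff (fun q => A * F q) p X = A * diff F p X := by
  rw [diff_mul (F := fun _ => A) (fun _ _ => differentiableAt_const _) hF, diff_const]; simp

theorem diff_mul_const (A : M2) (hF : ∀ i j, DifferentiableAt ℝ (fun q => F q i j) p)
    (X : ℝ × ℝ) : diff (fun q => F q * A) p X = diff F p X * A := by
  rw [diff_mul (H := fun _ => A) hF (fun _ _ => differentiableAt_const _), diff_const]; simp

theorem diff_congr (hD : IsOpen D) (hp : p ∈ D) (h : ∀ q ∈ D, F q = H q) (X : ℝ × ℝ) :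
    diff F p X = diff H p X := by
  ext i j
  simp only [diff, Matrix.of_apply]
  rw [Filter.EventuallyEq.fderiv_eq]
  filter_upwards [hD.mem_nhds hp] with q hq using by rw [h q hq]

theorem diff_neg (F : ℝ × ℝ → M2) (p X : ℝ × ℝ) : diff (fun q => -F q) p X = -diff F p X := by
  ext i j; simp [diff, fderiv_fun_neg]

theorem diff_vec_add (F : ℝ × ℝ → M2) (p X Y : ℝ × ℝ) :
    diff F p (X + Y) = diff F p X + diff F p Y := by
  ext i j; simp [diff]

theorem diff_vec_neg (F : ℝ × ℝ → M2) (p X : ℝ × ℝ) : diff F p (-X) = -diff F p X := by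
  ext i j; simp [diff]

theorem diff_diff_comm (hF : SmoothOn D F) (hD : IsOpen D) (hp : p ∈ D) (X Y : ℝ × ℝ) :
    diff (fun q => diff F q X) p Y = diff (fun q => diff F q Y) p X := by
  ext i j
  have hs : IsSymmSndFDerivAt ℝ (fun q => F q i j) p :=
    (hF.contDiffAt hD hp i j).isSymmSndFDerivAt (by
      rw [minSmoothness_of_isRCLikeNormedField]; exact WithTop.coe_le_coe.2 (le_top : (2 : ℕ∞) ≤ ⊤))
  have hd : DifferentiableAt ℝ (fderiv ℝ fun q => F q i j) p :=
    ((hF.contDiffAt hD hp i j).fderiv_right (m := ∞) (by simp)).differentiableAt (by simp)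
  simp only [diff, Matrix.of_apply]
  rw [fderiv_clm_apply hd (differentiableAt_const _), fderiv_clm_apply hd (differentiableAt_const _)]
  simpa using hs Y X

theorem eq_of_diff_eq_zero (hD : IsOpen D) (hc : IsPreconnected D) (hF : SmoothOn D F)
    (h : ∀ p ∈ D, ∀ X, diff F p X = 0) {p q : ℝ × ℝ} (hp : p ∈ D) (hq : q ∈ D) : F p = F q := by
  ext i j
  refine hD.is_const_of_fderiv_eq_zero (𝕜 := ℝ) hc ((hF i j).differentiableOn (by simp))
    (fun x hx => ?_) hp hq
  refine ContinuousLinearMap.ext fun X => ?_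
  simpa [diff] using congrFun (congrFun (h x hx X) i) j

/-! ### Maurer-Cartan forms of maps into `G`. -/

/-- Differentiate `Ψ Ψ⁻¹ = 1` and multiply by `Ψ⁻¹` on the left. -/
theorem diff_inv {Ψ : ℝ × ℝ → G} (h : SmoothOn D fun p => (Ψ p : M2)) (hD : IsOpen D)
    (hp : p ∈ D) (X : ℝ × ℝ) :
    diff (fun q => (((Ψ q)⁻¹ : G) : M2)) p X = -(mcForm Ψ p X * (((Ψ p)⁻¹ : G) : M2)) := by
  have e := diff_mul (h.differentiableAt hD hp) (h.inv.differentiableAt hD hp) X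
  simp only [coe_mul_inv, diff_const] at e
  have e' := congrArg (fun A => (((Ψ p)⁻¹ : G) : M2) * A) e
  simp only [Matrix.mul_zero, Matrix.mul_add, ← Matrix.mul_assoc, coe_inv_mul,
    Matrix.one_mul] at e'
  exact eq_neg_of_add_eq_zero_right e'.symm

theorem diff_eq_mul_mcForm (Ψ : ℝ × ℝ → G) (p X : ℝ × ℝ) :
    diff (fun q => (Ψ q : M2)) p X = (Ψ p : M2) * mcForm Ψ p X := by
  rw [mcForm, ← Matrix.mul_assoc, coe_mul_inv, Matrix.one_mul]

/-- Two maps into `G` with the same Maurer-Cartan form differ by a left translation. -/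
theorem exists_eq_mul_of_mcForm_eq {Φ Ψ : ℝ × ℝ → G} (hD : IsOpen D) (hc : IsPreconnected D)
    (hΦ : SmoothOn D fun p => (Φ p : M2)) (hΨ : SmoothOn D fun p => (Ψ p : M2))
    (h : ∀ p ∈ D, ∀ X, mcForm Φ p X = mcForm Ψ p X) : ∃ g : G, ∀ p ∈ D, Φ p = g * Ψ p := by
  obtain rfl | ⟨p₀, hp₀⟩ := D.eq_empty_or_nonempty
  · exact ⟨1, by simp⟩
  refine ⟨Φ p₀ * (Ψ p₀)⁻¹, fun p hp => ?_⟩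
  rw [← mul_inv_eq_iff_eq_mul]
  refine Subtype.ext ?_
  simp only [Matrix.SpecialLinearGroup.coe_mul]
  -- The derivative of `Φ Ψ⁻¹` is `Φ (β - α) Ψ⁻¹`, where `β` and `α` are the two equal Maurer-Cartan
  -- forms.
  refine eq_of_diff_eq_zero hD hc (hΦ.mul hΨ.inv) (fun q hq X => ?_) hp hp₀
  rw [diff_mul (hΦ.differentiableAt hD hq) (hΨ.inv.differentiableAt hD hq), diff_inv hΨ hD hq,
    diff_eq_mul_mcForm, h q hq]
  simp [Matrix.mul_assoc]

/-- This is the derivative of `det Ψ = 1`. -/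
theorem trace_mcForm {Ψ : ℝ × ℝ → G} (h : SmoothOn D fun p => (Ψ p : M2)) (hD : IsOpen D)
    (hp : p ∈ D) (X : ℝ × ℝ) : (mcForm Ψ p X).trace = 0 := by
  have hd := h.differentiableAt hD hp
  have e : (fun q => (Ψ q : M2) 0 0 * (Ψ q : M2) 1 1 - (Ψ q : M2) 0 1 * (Ψ q : M2) 1 0) =
      fun _ => (1 : ℝ) := by
    ext q; rw [← Matrix.det_fin_two]; exact (Ψ q).2
  have e1 := congrArg (fun f => fderiv ℝ f p X) e
  rw [fderiv_fun_sub ((hd 0 0).fun_mul (hd 1 1)) ((hd 0 1).fun_mul (hd 1 0)),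
    fderiv_fun_mul (hd 0 0) (hd 1 1), fderiv_fun_mul (hd 0 1) (hd 1 0)] at e1
  simp at e1
  rw [mcForm, coe_inv, Matrix.eta_fin_two (diff _ p X)]
  simp [Matrix.trace_fin_two, diff]
  linarith

end Calculus

/-! ### The adjoint action -/

theorem Ad_mul (g h : G) (x : M2) : Ad (g * h) x = Ad g (Ad h x) := by
  simp only [Ad, mul_inv_rev, Matrix.SpecialLinearGroup.coe_mul, Matrix.mul_assoc]

theorem Ad_one (x : M2) : Ad 1 x = x := by simp [Ad]

theorem Ad_inv_Ad (g : G) (x : M2) : Ad g⁻¹ (Ad g x) = x := by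
  rw [← Ad_mul]; simp [Ad_one]

theorem Ad_injective (g : G) : Function.Injective (Ad g) := fun x y h => by
  rw [← Ad_inv_Ad g x, h, Ad_inv_Ad]

theorem trace_Ad (g : G) (x : M2) : (Ad g x).trace = x.trace := by
  rw [Ad, Matrix.trace_mul_comm, ← Matrix.mul_assoc, coe_inv_mul, Matrix.one_mul]

theorem Ad_mul_Ad (g : G) (x y : M2) : Ad g x * Ad g y = Ad g (x * y) := by
  simp only [Ad, Matrix.mul_assoc]
  rw [← Matrix.mul_assoc _ (g : M2), coe_inv_mul, Matrix.one_mul]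

theorem sprod_Ad (g : G) (x y : M2) : sprod (Ad g x) (Ad g y) = sprod x y := by
  simp [sprod, Ad_mul_Ad, trace_Ad]

theorem Ad_mem_S21 (g : G) {x : M2} (hx : x ∈ S21) : Ad g x ∈ S21 :=
  ⟨(trace_Ad g x).trans hx.1, (sprod_Ad g x x).trans hx.2⟩

theorem isotropyElt_coe {l : ℝ} (hl : 0 < l) : (isotropyElt l : M2) = !![l⁻¹, 0; 0, l] := by
  ext i j
  fin_cases i <;> fin_cases j <;>
    simp [isotropyElt, qk, Real.cosh_eq, Real.sinh_eq, Real.exp_neg, Real.exp_log hl] <;> ring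

theorem isotropyElt_inv_coe {l : ℝ} (hl : 0 < l) :
    (((isotropyElt l)⁻¹ : G) : M2) = !![l, 0; 0, l⁻¹] := by
  rw [coe_inv, isotropyElt_coe hl]; simp

theorem isotropyElt_one : isotropyElt 1 = 1 := by
  refine Subtype.ext ?_
  rw [isotropyElt_coe one_pos]
  ext i j; fin_cases i <;> fin_cases j <;> simp

theorem Ad_inv_isotropyElt (l : ℝ) : Ad (isotropyElt l)⁻¹ qk = qk := by
  conv_lhs => rw [← isotropyElt_fixes l]
  exact Ad_inv_Ad _ _

/-- The isotropy group of `𝐤'` is commutative. -/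
theorem commute_isotropyElt {g : G} (hg : Ad g qk = qk) (l : ℝ) : Commute g (isotropyElt l) := by
  have h : (g : M2) * qk = qk * g := by
    have := congrArg (fun A => A * (g : M2)) hg
    simpa only [Ad, Matrix.mul_assoc, coe_inv_mul, Matrix.mul_one] using this
  refine Subtype.ext ?_
  rw [Matrix.SpecialLinearGroup.coe_mul, Matrix.SpecialLinearGroup.coe_mul]
  -- The element is a linear combination of `1` and `qk`, so commuting with `qk` is enough.
  simp [isotropyElt, Matrix.mul_add, Matrix.add_mul, h]

theorem mul_self_of_mem_S21 {x : M2} (hx : x ∈ S21) : x * x = 1 := by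
  have h := mul_add_mul_swap x x hx.1 hx.1
  rw [hx.2, ← two_smul ℝ (x * x)] at h
  exact smul_right_injective M2 (two_ne_zero' ℝ) (by simpa using h)

/-! ### Lorentz conformal maps are harmonic -/

section Conformal

variable {D : Set (ℝ × ℝ)} {ψ φ : ℝ × ℝ → M2}

theorem IsLorentzConformal.congr (h : IsLorentzConformal D ψ) (hD : IsOpen D)
    (e : ∀ p ∈ D, φ p = ψ p) : IsLorentzConformal D φ where
  smooth := h.smooth.congr e
  mapsTo p hp := by rw [e p hp]; exact h.mapsTo hp
  comm p hp X := by
    rw [diff_congr hD hp e, diff_congr hD hp e, e p hp]; exact h.comm p hp X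

theorem diff_Ad (hψ : SmoothOn D ψ) (hD : IsOpen D) (g : G) {p : ℝ × ℝ} (hp : p ∈ D)
    (X : ℝ × ℝ) : diff (fun q => Ad g (ψ q)) p X = Ad g (diff ψ p X) := by
  unfold Ad
  rw [diff_mul_const _ (((smoothOn_const (g : M2)).mul hψ).differentiableAt hD hp),
    diff_const_mul _ (hψ.differentiableAt hD hp)]

theorem IsLorentzConformal.Ad (h : IsLorentzConformal D ψ) (hD : IsOpen D) (g : G) :
    IsLorentzConformal D fun p => Ad g (ψ p) where
  smooth := ((smoothOn_const _).mul h.smooth).mul (smoothOn_const _)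
  mapsTo p hp := Ad_mem_S21 g (h.mapsTo hp)
  comm p hp X := by
    rw [diff_Ad h.smooth hD g hp, diff_Ad h.smooth hD g hp, sphereK_Ad, h.comm p hp]

/-- Differentiate `ψ² = 1`. -/
theorem IsLorentzConformal.anticomm (h : IsLorentzConformal D ψ) (hD : IsOpen D) {p : ℝ × ℝ}
    (hp : p ∈ D) (X : ℝ × ℝ) : diff ψ p X * ψ p + ψ p * diff ψ p X = 0 := by
  have hd := h.smooth.differentiableAt hD hp
  rw [← diff_mul hd hd, diff_congr (H := fun _ => 1) hD hp
    (fun q hq => mul_self_of_mem_S21 (h.mapsTo hq)), diff_const]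

/-- Since `ψ` anticommutes with its derivative, the half commutator in `sphereK` is just the
product. Conformality thereby becomes linear algebra in the matrix ring. -/
theorem IsLorentzConformal.mul_diff (h : IsLorentzConformal D ψ) (hD : IsOpen D) {p : ℝ × ℝ}
    (hp : p ∈ D) (X : ℝ × ℝ) : ψ p * diff ψ p X = diff ψ p (planeK X) := by
  rw [h.comm p hp, sphereK, eq_neg_of_add_eq_zero_left (h.anticomm hD hp X), sub_neg_eq_add,
    ← two_smul ℝ (ψ p * _), smul_smul]
  norm_num

theorem IsLorentzConformal.trace_diff (h : IsLorentzConformal D ψ) {p : ℝ × ℝ}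
    (hp : p ∈ D) (X : ℝ × ℝ) : (diff ψ p X).trace = 0 := by
  have e := h.comm p hp (planeK X)
  rw [show planeK (planeK X) = X by simp [planeK]] at e
  rw [e, sphereK, Matrix.trace_smul, Matrix.trace_sub, Matrix.trace_mul_comm, sub_self, smul_zero]

/-- Differentiate `ψ ψ_u = ψ_u` in `v` and `ψ ψ_v = -ψ_v` in `u`. In the sum the right-hand sides
cancel, and `ψ_u ψ_v + ψ_v ψ_u` is twice the scalar product, so `ψ ψ_uv = -⟨ψ_u, ψ_v⟩ 1`.
Multiplying by `ψ` gives the equation. -/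
theorem IsLorentzConformal.isHarmonic (h : IsLorentzConformal D ψ) (hD : IsOpen D) :
    IsHarmonic D ψ := by
  refine ⟨h.smooth, h.mapsTo, fun p hp => ?_⟩
  have hd := h.smooth.differentiableAt hD hp
  have hdu := (h.smooth.diff hD (1, 0)).differentiableAt hD hp
  have hdv := (h.smooth.diff hD (0, 1)).differentiableAt hD hp
  have eu : ∀ q ∈ D, ψ q * diff ψ q (1, 0) = diff ψ q (1, 0) := fun q hq => by
    rw [h.mul_diff hD hq]; simp [planeK]
  have ev : ∀ q ∈ D, ψ q * diff ψ q (0, 1) = -diff ψ q (0, 1) := fun q hq => by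
    rw [h.mul_diff hD hq, ← diff_vec_neg]; simp [planeK]
  have e1 := diff_mul hd hdu (0, 1)
  rw [diff_congr hD hp eu, diff_diff_comm h.smooth hD hp] at e1
  have e2 := diff_mul hd hdv (1, 0)
  rw [diff_congr hD hp ev, diff_neg] at e2
  have es := mul_add_mul_swap _ _ (h.trace_diff hp (1, 0)) (h.trace_diff hp (0, 1))
  set W := diff (fun q => diff ψ q (0, 1)) p (1, 0)
  set m := sprod (diff ψ p (1, 0)) (diff ψ p (0, 1))
  have e3 : ψ p * W = -(m • (1 : M2)) := by
    have : (2 : ℝ) • (ψ p * W) = (2 : ℝ) • -(m • (1 : M2)) := by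
      have e4 : (2 * m) • (1 : M2) + (2 : ℝ) • (ψ p * W) = 0 := by
        rw [← es, two_smul]
        calc _ = (diff ψ p (0, 1) * diff ψ p (1, 0) + ψ p * W) +
              (diff ψ p (1, 0) * diff ψ p (0, 1) + ψ p * W) := by abel
          _ = 0 := by rw [← e1, ← e2]; abel
      rw [eq_neg_of_add_eq_zero_right e4, smul_neg, smul_smul]
    exact smul_right_injective M2 (two_ne_zero' ℝ) this
  have e5 : W = -(m • ψ p) := by
    have := congrArg (fun A => ψ p * A) e3
    simpa [← Matrix.mul_assoc, mul_self_of_mem_S21 (h.mapsTo hp)] using this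
  rw [e5, smul_neg, smul_smul, neg_add_cancel]

/-! ### Extended framings of Lorentz conformal maps -/

theorem IsFraming.diff_eq {Ψ : ℝ × ℝ → G} (hΨ : IsFraming D ψ Ψ) (hD : IsOpen D) {p : ℝ × ℝ}
    (hp : p ∈ D) (X : ℝ × ℝ) :
    diff ψ p X = LorentzSphere.Ad (Ψ p) (mcForm Ψ p X * qk - qk * mcForm Ψ p X) := by
  rw [diff_congr hD hp fun q hq => (hΨ.proj q hq).symm]
  unfold LorentzSphere.Ad
  rw [diff_mul ((hΨ.smooth.mul (smoothOn_const qk)).differentiableAt hD hp)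
    (hΨ.smooth.inv.differentiableAt hD hp), diff_mul_const _ (hΨ.smooth.differentiableAt hD hp),
    diff_inv hΨ.smooth hD hp, diff_eq_mul_mcForm]
  simp only [Matrix.mul_add, Matrix.add_mul, Matrix.mul_assoc, Matrix.mul_neg, Matrix.neg_mul,
    sub_eq_add_neg]

/-- Invariance of `sphereK` under `Ad` moves the conformality condition from `ψ p` to the origin
`𝐤'`. -/
theorem IsFraming.comm_mcForm {Ψ : ℝ × ℝ → G} (hΨ : IsFraming D ψ Ψ)
    (hψ : IsLorentzConformal D ψ) (hD : IsOpen D) {p : ℝ × ℝ} (hp : p ∈ D) (X : ℝ × ℝ) :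
    mcForm Ψ p (planeK X) * qk - qk * mcForm Ψ p (planeK X) =
      sphereK qk (mcForm Ψ p X * qk - qk * mcForm Ψ p X) := by
  apply Ad_injective (Ψ p)
  rw [← hΨ.diff_eq hD hp, hψ.comm p hp, hΨ.diff_eq hD hp, ← sphereK_Ad, hΨ.proj p hp]

theorem mcForm_add (Ψ : ℝ × ℝ → G) (p X Y : ℝ × ℝ) :
    mcForm Ψ p (X + Y) = mcForm Ψ p X + mcForm Ψ p Y := by
  simp [mcForm, diff_vec_add, Matrix.mul_add]

theorem mcForm_neg (Ψ : ℝ × ℝ → G) (p X : ℝ × ℝ) : mcForm Ψ p (-X) = -mcForm Ψ p X := by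
  simp [mcForm, diff_vec_neg]

theorem comm_qk (x : M2) : x * qk - qk * x = !![0, 2 * x 0 1; -2 * x 1 0, 0] := by
  rw [Matrix.eta_fin_two x, qk]
  ext i j; fin_cases i <;> fin_cases j <;> simp <;> ring

theorem sphereK_qk (a b : ℝ) : sphereK qk !![0, a; b, 0] = !![0, -a; b, 0] := by
  ext i j; fin_cases i <;> fin_cases j <;> simp [sphereK, qk] <;> ring

/-- For a framing of a Lorentz conformal map, the spectral parameter acts by conjugation. -/
theorem IsFraming.spectralForm_eq {Ψ : ℝ × ℝ → G} (hΨ : IsFraming D ψ Ψ)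
    (hψ : IsLorentzConformal D ψ) (hD : IsOpen D) {l : ℝ} (hl : 0 < l) {p : ℝ × ℝ} (hp : p ∈ D)
    (X : ℝ × ℝ) : spectralForm Ψ l p X =
      LorentzSphere.Ad (isotropyElt (l ^ (1 / 2 : ℝ))) (mcForm Ψ p X) := by
  have ht : 0 < l ^ (1 / 2 : ℝ) := Real.rpow_pos_of_pos hl _
  have htl : l = l ^ (1 / 2 : ℝ) * l ^ (1 / 2 : ℝ) := by
    rw [← Real.rpow_add hl]; norm_num
  -- `planeK` fixes `∂/∂u`, while `sphereK qk` negates the upper-right entry; that entry must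
  -- vanish. For `∂/∂v` the signs are reversed.
  have eu : mcForm Ψ p (X.1, 0) 0 1 = 0 := by
    have := congrFun (congrFun (hΨ.comm_mcForm hψ hD hp (X.1, 0)) 0) 1
    rw [show planeK (X.1, 0) = (X.1, 0) by simp [planeK], comm_qk, sphereK_qk] at this
    simp at this
    linarith
  have ev : mcForm Ψ p (0, X.2) 1 0 = 0 := by
    have := congrFun (congrFun (hΨ.comm_mcForm hψ hD hp (0, X.2)) 1) 0
    rw [show planeK (0, X.2) = -(0, X.2) by simp [planeK], mcForm_neg, comm_qk, comm_qk,
      sphereK_qk] at this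
    simp at this
    linarith
  -- With trace zero, the diagonal of the form is exactly its `kPart`.
  have htr := trace_mcForm hΨ.smooth hD hp X
  rw [Matrix.trace_fin_two] at htr
  have hX : mcForm Ψ p X = mcForm Ψ p (X.1, 0) + mcForm Ψ p (0, X.2) := by
    rw [← mcForm_add]; simp
  have h01 : mcForm Ψ p X 0 1 = mcForm Ψ p (0, X.2) 0 1 := by rw [hX]; simp [eu]
  have h10 : mcForm Ψ p X 1 0 = mcForm Ψ p (X.1, 0) 1 0 := by rw [hX]; simp [ev]
  rw [spectralForm, LorentzSphere.Ad, isotropyElt_coe ht, isotropyElt_inv_coe ht]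
  generalize l ^ (1 / 2 : ℝ) = t at *
  subst htl
  have ht0 := ht.ne'
  rw [Matrix.eta_fin_two (mcForm Ψ p X), h01, h10]
  ext i j
  fin_cases i <;> fin_cases j <;> simp [kPart, mPart, qk, eu, ev] <;> field_simp <;> linarith

/-- The constant left factor cancels, and the right factor `h⁻¹` acts by conjugation. -/
theorem mcForm_translate {Ψ : ℝ × ℝ → G} (hΨ : SmoothOn D fun p => (Ψ p : M2)) (hD : IsOpen D)
    (g h : G) {p : ℝ × ℝ} (hp : p ∈ D) (X : ℝ × ℝ) :
    mcForm (fun q => g * Ψ q * h⁻¹) p X = LorentzSphere.Ad h (mcForm Ψ p X) := by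
  rw [mcForm]
  simp only [mul_inv_rev, inv_inv, Matrix.SpecialLinearGroup.coe_mul]
  rw [diff_mul_const _ (((smoothOn_const _).mul hΨ).differentiableAt hD hp),
    diff_const_mul _ (hΨ.differentiableAt hD hp), LorentzSphere.Ad, mcForm]
  simp only [Matrix.mul_assoc]
  rw [← Matrix.mul_assoc _ (g : M2), coe_inv_mul, Matrix.one_mul]

theorem smoothOn_translate {Ψ : ℝ × ℝ → G} (hΨ : SmoothOn D fun p => (Ψ p : M2)) (g h : G) :
    SmoothOn D fun p => ((g * Ψ p * h⁻¹ : G) : M2) := by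
  simp only [Matrix.SpecialLinearGroup.coe_mul]
  exact ((smoothOn_const _).mul hΨ).mul (smoothOn_const _)

/-- The right factor alone produces `α_λ`. The left factor makes the projection `Ad(h) ψ`, and
cancels the right one wherever `Ψ` takes values in `K`. -/
theorem IsFraming.isExtendedFraming {Ψ : ℝ × ℝ → G} (hΨ : IsFraming D ψ Ψ)
    (hψ : IsLorentzConformal D ψ) (hD : IsOpen D) :
    IsExtendedFraming D ψ fun l p => isotropyElt (l ^ (1 / 2 : ℝ)) * Ψ p *
      (isotropyElt (l ^ (1 / 2 : ℝ)))⁻¹ := by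
  have h1 : (fun p => isotropyElt ((1 : ℝ) ^ (1 / 2 : ℝ)) * Ψ p *
      (isotropyElt ((1 : ℝ) ^ (1 / 2 : ℝ)))⁻¹) = Ψ := by
    simp [isotropyElt_one]
  refine ⟨by simpa only [h1] using hΨ, fun l _ => smoothOn_translate hΨ.smooth _ _,
    fun l hl p hp X => ?_⟩
  simp only [h1]
  rw [diff_eq_mul_mcForm, mcForm_translate hΨ.smooth hD _ _ hp, hΨ.spectralForm_eq hψ hD hl hp]

/-- Both maps have Maurer-Cartan form `α_λ = Ad(h) α`, with `h = λ^(1/2)`. -/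
theorem IsExtendedFraming.exists_eq_mul {F : ℝ → ℝ × ℝ → G} (hF : IsExtendedFraming D ψ F)
    (hψ : IsLorentzConformal D ψ) (hD : IsOpen D) (hc : IsPreconnected D) {l : ℝ} (hl : 0 < l) :
    ∃ g : G, ∀ p ∈ D, F l p = g * (F 1 p * (isotropyElt (l ^ (1 / 2 : ℝ)))⁻¹) := by
  have hs := hF.framing.smooth
  have e := smoothOn_translate hs 1 (isotropyElt (l ^ (1 / 2 : ℝ)))
  simp only [one_mul] at e
  refine exists_eq_mul_of_mcForm_eq hD hc (hF.smooth l hl) e fun p hp X => ?_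
  have e2 := mcForm_translate hs hD 1 (isotropyElt (l ^ (1 / 2 : ℝ))) hp X
  simp only [one_mul] at e2
  rw [e2, mcForm, hF.eqn l hl p hp, ← Matrix.mul_assoc, coe_inv_mul, Matrix.one_mul,
    hF.framing.spectralForm_eq hψ hD hl hp]

theorem Ad_translate_qk (g h : G) (l : ℝ) :
    LorentzSphere.Ad (g * (h * (isotropyElt l)⁻¹)) qk =
      LorentzSphere.Ad g (LorentzSphere.Ad h qk) := by
  rw [Ad_mul, Ad_mul, Ad_inv_isotropyElt]

end Conformal

/-! ### Existence of framings -/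

/-- A continuous square root of a smooth nowhere vanishing complex function is smooth. -/
theorem contDiffAt_of_sq {E : Type*} [NormedAddCommGroup E] [NormedSpace ℝ E] {f w : E → ℂ}
    {x : E} {n : WithTop ℕ∞} (hf : ContinuousAt f x) (hw : ContDiffAt ℝ n w x)
    (h : ∀ᶠ y in nhds x, f y ^ 2 = w y) (h0 : f x ≠ 0) : ContDiffAt ℝ n f x := by
  -- Near `x` the quotient `f / f x` stays in the right half-plane, where the principal root inverts
  -- squaring.
  have hre : ∀ᶠ y in nhds x, 0 < (f y / f x).re := by
    have : ContinuousAt (fun y => (f y / f x).re) x :=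
      Complex.continuous_re.continuousAt.comp (hf.div_const _)
    refine this.eventually (lt_mem_nhds ?_)
    simp [h0]
  have e : f =ᶠ[nhds x] fun y => f x * (w y / f x ^ 2) ^ (2⁻¹ : ℂ) := by
    filter_upwards [h, hre] with y hy hy'
    rw [← hy, ← div_pow, Complex.sq_cpow_two_inv hy']
    field_simp
  refine ContDiffAt.congr_of_eventuallyEq ?_ e
  have hx : w x / f x ^ 2 = 1 := by rw [← h.self_of_nhds]; field_simp
  have hc : ContDiffAt ℂ n (fun z : ℂ => z ^ (2⁻¹ : ℂ)) (w x / f x ^ 2) := by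
    have : ∀ᶠ z in nhds (w x / f x ^ 2), z ^ (2⁻¹ : ℂ) = Complex.exp (Complex.log z * 2⁻¹) := by
      rw [hx]
      filter_upwards [isOpen_ne.mem_nhds (one_ne_zero (α := ℂ))] with z hz
      exact Complex.cpow_def_of_ne_zero hz _
    refine ContDiffAt.congr_of_eventuallyEq ?_ this
    exact ((Complex.contDiffAt_log (by rw [hx]; simp)).mul contDiffAt_const).cexp
  exact contDiffAt_const.mul (ContDiffAt.comp (g := fun z : ℂ => z ^ (2⁻¹ : ℂ)) x
    (hc.restrict_scalars ℝ) (hw.div_const _))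

/-- The algebra of the lift: a vector `a` with `(a₀ + i a₁)² = c₁² + c₂²`, where `c₁, c₂` are the
columns of `1 - x` as complex numbers, is the first column of a matrix conjugating `𝐤'` to `x`. -/
theorem eigenvector_of_sq {p q r a b : ℝ} (hx : p ^ 2 + q * r = 1)
    (hre : a ^ 2 - b ^ 2 = (1 - p) ^ 2 - r ^ 2 + q ^ 2 - (1 + p) ^ 2)
    (him : a * b = -(1 - p) * r - q * (1 + p)) :
    a ^ 2 + b ^ 2 = 2 + 2 * p ^ 2 + q ^ 2 + r ^ 2 ∧ (p + 1) * a + q * b = 0 ∧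
      r * a + (1 - p) * b = 0 := by
  have hN : a ^ 2 + b ^ 2 = 2 + 2 * p ^ 2 + q ^ 2 + r ^ 2 := by
    -- As `det (1 - x) = 0`, the columns `c₁, c₂` are parallel, so `|c₁² + c₂²| = |c₁|² + |c₂|²`;
    -- this is compared with `|z²| = |z|²` for `z = a + ib`.
    have h1 : (a ^ 2 + b ^ 2) ^ 2 = (2 + 2 * p ^ 2 + q ^ 2 + r ^ 2) ^ 2 := by
      have : (a ^ 2 + b ^ 2) ^ 2 = (a ^ 2 - b ^ 2) ^ 2 + 4 * (a * b) ^ 2 := by ring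
      rw [this, hre, him]
      linear_combination (4 * (1 - p ^ 2 - q * r)) * hx
    exact (pow_left_inj₀ (by positivity) (by positivity) two_ne_zero).1 h1
  have ha : a ^ 2 = (1 - p) ^ 2 + q ^ 2 := by linarith
  have hb : b ^ 2 = r ^ 2 + (1 + p) ^ 2 := by linarith
  refine ⟨hN, ?_, ?_⟩
  -- Only `a²`, `b²` and `ab` are known, so the linear form is shown to vanish through its square.
  · have : ((p + 1) * a + q * b) ^ 2 = 0 := by
      have e : ((p + 1) * a + q * b) ^ 2 =
        (p + 1) ^ 2 * a ^ 2 + q ^ 2 * b ^ 2 + 2 * (p + 1) * q * (a * b) := by ring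
      rw [e, ha, hb, him]
      linear_combination (p ^ 2 + q * r - 1) * hx
    exact pow_eq_zero_iff two_ne_zero |>.1 this
  · have : (r * a + (1 - p) * b) ^ 2 = 0 := by
      have e : (r * a + (1 - p) * b) ^ 2 =
        r ^ 2 * a ^ 2 + (1 - p) ^ 2 * b ^ 2 + 2 * (1 - p) * r * (a * b) := by ring
      rw [e, ha, hb, him]
      linear_combination (p ^ 2 + q * r - 1) * hx
    exact pow_eq_zero_iff two_ne_zero |>.1 this

theorem exists_isFraming {D : Set (ℝ × ℝ)} (hD : IsOpen D) (hsc : IsSimplyConnected D)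
    {ψ : ℝ × ℝ → M2} (hs : SmoothOn D ψ) (hm : Set.MapsTo ψ D S21) :
    ∃ Ψ : ℝ × ℝ → G, IsFraming D ψ Ψ := by
  classical
  have h11 : ∀ y ∈ D, ψ y 1 1 = -ψ y 0 0 := fun y hy => by
    have := (hm hy).1
    rw [Matrix.trace_fin_two] at this
    linarith
  have hdet : ∀ y ∈ D, ψ y 0 0 ^ 2 + ψ y 0 1 * ψ y 1 0 = 1 := fun y hy => by
    have := congrFun (congrFun (mul_self_of_mem_S21 (hm hy)) 0) 0
    simp [Matrix.mul_apply, Fin.sum_univ_two] at this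
    linarith
  let P : ℝ × ℝ → ℝ := fun y =>
    (1 - ψ y 0 0) ^ 2 - ψ y 1 0 ^ 2 + ψ y 0 1 ^ 2 - (1 + ψ y 0 0) ^ 2
  let Q : ℝ × ℝ → ℝ := fun y => 2 * (-(1 - ψ y 0 0) * ψ y 1 0 - ψ y 0 1 * (1 + ψ y 0 0))
  let w : ℝ × ℝ → ℂ := fun y => (P y : ℂ) + (Q y : ℂ) * Complex.I
  have h00s := hs 0 0
  have h01s := hs 0 1
  have h10s := hs 1 0
  have hP : ContDiffOn ℝ ∞ P D := by fun_prop
  have hQ : ContDiffOn ℝ ∞ Q D := by fun_prop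
  have hw : ContDiffOn ℝ ∞ w D :=
    (Complex.ofRealCLM.contDiff.comp_contDiffOn hP).add
      ((Complex.ofRealCLM.contDiff.comp_contDiffOn hQ).mul contDiffOn_const)
  have hsq : ∀ (f : ℂ) (y : ℝ × ℝ), f ^ 2 = w y →
      f.re ^ 2 - f.im ^ 2 = P y ∧ f.re * f.im = Q y / 2 := fun f y e => by
    have e1 := congrArg Complex.re e
    have e2 := congrArg Complex.im e
    simp [w, sq] at e1 e2
    constructor <;> linarith
  have hkey : ∀ (f : ℂ), ∀ y ∈ D, f ^ 2 = w y →
      f.re ^ 2 + f.im ^ 2 = 2 + 2 * ψ y 0 0 ^ 2 + ψ y 0 1 ^ 2 + ψ y 1 0 ^ 2 ∧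
      (ψ y 0 0 + 1) * f.re + ψ y 0 1 * f.im = 0 ∧
      ψ y 1 0 * f.re + (1 - ψ y 0 0) * f.im = 0 := fun f y hy e =>
    eigenvector_of_sq (hdet y hy) (hsq f y e).1 (by rw [(hsq f y e).2]; simp [Q])
  have hw0 : (0 : ℂ) ∉ w '' D := by
    rintro ⟨y, hy, e⟩
    have := (hkey 0 y hy (by simp [e])).1
    simp at this
    nlinarith [sq_nonneg (ψ y 0 0), sq_nonneg (ψ y 0 1), sq_nonneg (ψ y 1 0)]
  obtain ⟨f, hfc, hf⟩ := Complex.exists_continuousOn_pow_eq hsc hD hw.continuousOn hw0 two_ne_zero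
  have hfs : ContDiffOn ℝ ∞ f D := fun y hy => by
    refine (contDiffAt_of_sq (hfc.continuousAt (hD.mem_nhds hy)) (hw.contDiffAt (hD.mem_nhds hy))
      (.of_forall hf) fun h0 => hw0 ⟨y, hy, ?_⟩).contDiffWithinAt
    rw [← hf y, h0]; simp
  have hare : ContDiffOn ℝ ∞ (fun y => (f y).re) D := Complex.reCLM.contDiff.comp_contDiffOn hfs
  have haim : ContDiffOn ℝ ∞ (fun y => (f y).im) D := Complex.imCLM.contDiff.comp_contDiffOn hfs
  let N : ℝ × ℝ → ℝ := fun y => 2 * (2 + 2 * ψ y 0 0 ^ 2 + ψ y 0 1 ^ 2 + ψ y 1 0 ^ 2)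
  have hN : ContDiffOn ℝ ∞ N D := by fun_prop
  have hN0 : ∀ y, N y ≠ 0 := fun y => by positivity
  -- The first column `a` spans the (-1)-eigenline of `ψ`. The second is `(1 + ψ) J a / (2|a|²)`,
  -- with `J` the quarter turn: it lies in the (+1)-eigenline, and the scaling makes the determinant
  -- `1`.
  let A : ℝ × ℝ → M2 := fun y =>
    !![(f y).re, (ψ y 0 1 * (f y).re - (1 + ψ y 0 0) * (f y).im) / N y;
      (f y).im, ((1 - ψ y 0 0) * (f y).re - ψ y 1 0 * (f y).im) / N y]
  have hA : SmoothOn D A := by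
    intro i j
    fin_cases i <;> fin_cases j
    · exact hare
    · exact ContDiffOn.div (by fun_prop) hN fun y _ => hN0 y
    · exact haim
    · exact ContDiffOn.div (by fun_prop) hN fun y _ => hN0 y
  have hAdet : ∀ y ∈ D, (A y).det = 1 := fun y hy => by
    obtain ⟨k1, k2, k3⟩ := hkey (f y) y hy (hf y)
    have := hN0 y
    simp only [Matrix.det_fin_two, A, Matrix.of_apply, Matrix.cons_val', Matrix.cons_val_zero,
      Matrix.cons_val_one, Matrix.cons_val_fin_one]
    field_simp
    simp only [N]
    linear_combination 2 * k1 - (f y).im * k3 - (f y).re * k2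
  have hAψ : ∀ y ∈ D, A y * qk = ψ y * A y := fun y hy => by
    obtain ⟨k1, k2, k3⟩ := hkey (f y) y hy (hf y)
    have := hN0 y
    have hd := hdet y hy
    ext i j
    fin_cases i <;> fin_cases j <;>
      simp [A, qk, Matrix.mul_apply, Fin.sum_univ_two, h11 y hy]
    · linarith
    · field_simp
      linear_combination (f y).im * hd
    · linarith
    · field_simp
      linear_combination -(f y).re * hd
  -- The default `1` is never used on `D`, where the determinant is `1`.
  let Ψ : ℝ × ℝ → G := fun y => if h : (A y).det = 1 then ⟨A y, h⟩ else 1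
  have hΨ : ∀ y ∈ D, (Ψ y : M2) = A y := fun y hy => by simp [Ψ, hAdet y hy]
  refine ⟨Ψ, hA.congr hΨ, fun y hy => ?_⟩
  rw [Ad, hΨ y hy, hAψ y hy, ← hΨ y hy, Matrix.mul_assoc, coe_mul_inv, Matrix.mul_one]

end LorentzSphere

/-! ### Determination of the associated families. -/

theorem corollary7p2 (D : Set (ℝ × ℝ)) (hD : IsOpen D) (hsc : IsSimplyConnected D)
    (ψ : ℝ × ℝ → LorentzSphere.M2) (hψ : LorentzSphere.IsLorentzConformal D ψ) :
    -- the associated family exists and, normalized at a point over `𝐤'`, is `l ↦ l^(1/2) ψ`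
    (∀ p₀ ∈ D, ψ p₀ = LorentzSphere.qk →
      (∃ fam, LorentzSphere.IsAssociatedFamilyAt D ψ p₀ fam) ∧
      ∀ fam, LorentzSphere.IsAssociatedFamilyAt D ψ p₀ fam → ∀ l : ℝ, 0 < l →
        LorentzSphere.IsHarmonic D (fam l) ∧
        ∀ p ∈ D, fam l p =
          LorentzSphere.Ad (LorentzSphere.isotropyElt (l ^ (1 / 2 : ℝ))) (ψ p)) ∧
    -- without normalization: `l ↦ l^(1/2) ψ` is an associated family, and every other one
    -- differs from it, for each `l`, by the action of an element of `G`
    LorentzSphere.IsAssociatedFamily D ψ (fun l p =>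
      LorentzSphere.Ad (LorentzSphere.isotropyElt (l ^ (1 / 2 : ℝ))) (ψ p)) ∧
    ∀ fam, LorentzSphere.IsAssociatedFamily D ψ fam → ∀ l : ℝ, 0 < l →
      LorentzSphere.IsHarmonic D (fam l) ∧
      ∃ g : LorentzSphere.G, ∀ p ∈ D, fam l p = LorentzSphere.Ad g
        (LorentzSphere.Ad (LorentzSphere.isotropyElt (l ^ (1 / 2 : ℝ))) (ψ p)) := by

  obtain ⟨Ψ, hΨ⟩ := LorentzSphere.exists_isFraming hD hsc hψ.smooth hψ.mapsTo
  have hc : IsPreconnected D := hsc.isPathConnected.isConnected.isPreconnected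
  have hext := hΨ.isExtendedFraming hψ hD
  have key : ∀ F : ℝ → ℝ × ℝ → LorentzSphere.G, LorentzSphere.IsExtendedFraming D ψ F →
      ∀ l : ℝ, 0 < l → ∃ g : LorentzSphere.G,
        (∀ p ∈ D, F l p = g * (F 1 p * (LorentzSphere.isotropyElt (l ^ (1 / 2 : ℝ)))⁻¹)) ∧
        ∀ p ∈ D, LorentzSphere.Ad (F l p) LorentzSphere.qk = LorentzSphere.Ad g (ψ p) := by
    intro F hF l hl
    obtain ⟨g, hg⟩ := hF.exists_eq_mul hψ hD hc hl
    refine ⟨g, hg, fun p hp => ?_⟩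
    rw [hg p hp, LorentzSphere.Ad_translate_qk, hF.framing.proj p hp]
  refine ⟨fun p₀ hp₀ hk => ⟨?_, ?_⟩, ⟨_, hext, fun l hl p hp => ?_⟩, ?_⟩
  · refine ⟨_, _, hext, fun l hl => ?_, fun l _ p _ => rfl⟩
    -- `Ψ p₀` lies in the isotropy group, so conjugation by `h` leaves it unchanged.
    have h := LorentzSphere.commute_isotropyElt ((hΨ.proj p₀ hp₀).trans hk)
    simp only [← (h _).eq, mul_inv_cancel_right]
  · rintro fam ⟨F, hF, hF₀, hfam⟩ l hl
    obtain ⟨g, hg, hgψ⟩ := key F hF l hl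
    have e : ∀ p ∈ D, fam l p = LorentzSphere.Ad g (ψ p) := fun p hp =>
      (hfam l hl p hp).trans (hgψ p hp)
    have hg' : g = LorentzSphere.isotropyElt (l ^ (1 / 2 : ℝ)) := by
      have h := LorentzSphere.commute_isotropyElt ((hF.framing.proj p₀ hp₀).trans hk)
        (l ^ (1 / 2 : ℝ))
      have h1 := hg p₀ hp₀
      -- Commuting `h⁻¹` past `F 1 p₀` and cancelling leaves `g h⁻¹ = 1`.
      rw [hF₀ l hl, h.inv_right.eq, ← mul_assoc, right_eq_mul, mul_inv_eq_one] at h1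
      exact h1
    refine ⟨((hψ.Ad hD g).congr hD e).isHarmonic hD, fun p hp => ?_⟩
    rw [e p hp, hg']
  · rw [mul_assoc, LorentzSphere.Ad_translate_qk, hΨ.proj p hp]
  · rintro fam ⟨F, hF, hfam⟩ l hl
    obtain ⟨g, -, hgψ⟩ := key F hF l hl
    have e : ∀ p ∈ D, fam l p = LorentzSphere.Ad g (ψ p) := fun p hp =>
      (hfam l hl p hp).trans (hgψ p hp)
    refine ⟨((hψ.Ad hD g).congr hD e).isHarmonic hD,
      g * (LorentzSphere.isotropyElt (l ^ (1 / 2 : ℝ)))⁻¹, fun p hp => ?_⟩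
    rw [e p hp, LorentzSphere.Ad_mul, LorentzSphere.Ad_inv_Ad]
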